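/- Let $D$ be an integral domain with quotient field $K$. Write $\overline{F}(D)$ for the set of nonzero $D$-submodules of $K$, and $(A:B)=\{x\in K\mid xB\subseteq A\}$ for $D$-submodules $A,B$ of $K$. A semistar operation on $D$ is a map $\overline{F}(D)\to\overline{F}(D)$, $E\mapsto E^\star$, such that for all nonzero $x\in K$ and all $E,F\in\overline{F}(D)$: $(xE)^\star=xE^\star$; $E\subseteq F$ implies $E^\star\subseteq F^\star$; $E\subseteq E^\star$ and $(E^\star)^\star=E^\star$. The associated finite-type operation $\star_f$ is given by $E^{\star_f}=\bigcup\{F^\star\mid F\in\overline{F}(D)\text{ finitely generated},\ F\subseteq E\}$. A quasi-$\star_f$-maximal ideal is an ideal of $D$ that is maximal among the nonzero proper ideals $I$ of $D$ with $I=I^{\star_f}\cap D$ (such an ideal is prime). The domain $D$ is $\star_f$-sharp if for every quasi-$\star_f$-maximal ideal $P$ the intersection $\bigcap D_M$ (in $K$, and equal to $K$ if it is empty), taken over all quasi-$\star_f$-maximal ideals $M$ with $M\not\supseteq P$, is not contained in $D_P$. The domain $D$ is a P$\star$MD (Prüfer $\star$-multiplication domain) if $(F(D:F))^{\star_f}=D^{\star_f}$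 for each finitely generated $F\in\overline{F}(D)$. An element $E\in\overline{F}(D)$ is $\star_f$-idempotent if $E^{\star_f}=(E^2)^{\star_f}$. (1) Let $\star$ be a semistar operation on $D$ such that $D$ is a $\star_f$-sharp P$\star$MD, and let $I$ be a nonzero ideal of $D$ with $(D^\star:I)=D^\star$. Then $I$ is $\star_f$-idempotent. (2) Let $v$ be the semistar operation $E\mapsto E^v=(D:(D:E))$ and let $t=v_f$. A P$v$MD is a domain in which $(I(D:I))^t=D$ for each nonzero finitely generated ideal $I$. If $D$ is a $t$-sharp P$v$MD (that is, $D$ is a P$v$MD and is $v_f$-sharp) and $I$ is a nonzero ideal of $D$ with $I^{-1}=(D:I)=D$, then $I$ is $t$-idempotent. -/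

import Mathlib

open scoped Pointwise

/-- A semistar operation on the integral domain `D` with quotient field `K`: a map `E ↦ E^⋆` on the
nonzero `D`-submodules of `K` subject to the three axioms below. The map is written as a total
function on submodules; its value at the zero submodule is unconstrained and is never used.
(That `E^⋆` is nonzero follows from `le_map`.) -/
structure SemistarOperation (D K : Type*) [CommRing D] [Field K] [Algebra D K] where
  toFun : Submodule D K → Submodule D K
  map_smul' : ∀ (x : K) (E : Submodule D K), x ≠ 0 → E ≠ ⊥ → toFun (x • E) = x • toFun E
  mono' : ∀ E F : Submodule D K, E ≠ ⊥ → F ≠ ⊥ → E ≤ F → toFun E ≤ toFun F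
  le_map' : ∀ E : Submodule D K, E ≠ ⊥ → E ≤ toFun E
  idem' : ∀ E : Submodule D K, E ≠ ⊥ → toFun (toFun E) = toFun E

namespace SemistarOperation

section

variable {D K : Type*} [CommRing D] [Field K] [Algebra D K]

instance : CoeFun (SemistarOperation D K) (fun _ => Submodule D K → Submodule D K) :=
  ⟨SemistarOperation.toFun⟩

theorem map_ne_bot (s : SemistarOperation D K) {E : Submodule D K} (hE : E ≠ ⊥) : s E ≠ ⊥ :=
  fun h => hE (le_bot_iff.mp (h ▸ s.le_map' E hE))

theorem smul_ne_bot {x : K} (hx : x ≠ 0) {E : Submodule D K} (hE : E ≠ ⊥) : x • E ≠ ⊥ := by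
  obtain ⟨y, hy, hy0⟩ := (Submodule.ne_bot_iff E).mp hE
  exact (Submodule.ne_bot_iff _).mpr
    ⟨x • y, Submodule.smul_mem_pointwise_smul y x E hy, by simp [hx, hy0]⟩

theorem fg_smul (x : K) {E : Submodule D K} (hE : E.FG) : (x • E).FG :=
  hE.map _

/-- The finitely generated nonzero `D`-submodules of `K` contained in `E`. -/
def fgBelow (E : Submodule D K) : Set (Submodule D K) :=
  {F | F ≠ ⊥ ∧ F.FG ∧ F ≤ E}

theorem fgBelow_nonempty {E : Submodule D K} (hE : E ≠ ⊥) : (fgBelow E).Nonempty := by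
  obtain ⟨y, hy, hy0⟩ := (Submodule.ne_bot_iff E).mp hE
  exact ⟨D ∙ y, by simpa using hy0, Submodule.fg_span_singleton y, by simpa using hy⟩

theorem directedOn_fgBelow (s : SemistarOperation D K) (E : Submodule D K) :
    DirectedOn (· ≤ ·) (s '' fgBelow E) := by
  rintro _ ⟨F, ⟨hF0, hF, hFE⟩, rfl⟩ _ ⟨G, ⟨hG0, hG, hGE⟩, rfl⟩
  have h0 : F ⊔ G ≠ ⊥ := fun h => hF0 (le_bot_iff.mp (h ▸ le_sup_left))
  exact ⟨s (F ⊔ G), ⟨F ⊔ G, ⟨h0, hF.sup hG, sup_le hFE hGE⟩, rfl⟩,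
    s.mono' _ _ hF0 h0 le_sup_left, s.mono' _ _ hG0 h0 le_sup_right⟩

/-- The supremum of the `F^⋆`, for `F` nonzero, finitely generated and contained in the nonzero
submodule `E`, is their union. -/
theorem mem_sSup_fgBelow (s : SemistarOperation D K) {E : Submodule D K} (hE : E ≠ ⊥) {x : K} :
    x ∈ sSup (s '' fgBelow E) ↔ ∃ F : Submodule D K, F ≠ ⊥ ∧ F.FG ∧ F ≤ E ∧ x ∈ s F := by
  rw [Submodule.mem_sSup_of_directed ((fgBelow_nonempty hE).image _) (s.directedOn_fgBelow E)]
  constructor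
  · rintro ⟨_, ⟨F, ⟨h0, h1, h2⟩, rfl⟩, hx⟩
    exact ⟨F, h0, h1, h2, hx⟩
  · rintro ⟨F, h0, h1, h2, hx⟩
    exact ⟨s F, ⟨F, ⟨h0, h1, h2⟩, rfl⟩, hx⟩

theorem le_sSup_fgBelow (s : SemistarOperation D K) {E : Submodule D K} (hE : E ≠ ⊥) :
    E ≤ sSup (s '' fgBelow E) := by
  intro x hx
  rw [s.mem_sSup_fgBelow hE]
  by_cases hx0 : x = 0
  · obtain ⟨F, h0, h1, h2⟩ := fgBelow_nonempty hE
    exact ⟨F, h0, h1, h2, hx0 ▸ Submodule.zero_mem _⟩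
  · have h0 : (D ∙ x) ≠ ⊥ := by simpa using hx0
    exact ⟨D ∙ x, h0, Submodule.fg_span_singleton x, by simpa using hx,
      s.le_map' _ h0 (Submodule.mem_span_singleton_self x)⟩

theorem sSup_fgBelow_ne_bot (s : SemistarOperation D K) {E : Submodule D K} (hE : E ≠ ⊥) :
    sSup (s '' fgBelow E) ≠ ⊥ :=
  fun h => hE (le_bot_iff.mp (h ▸ s.le_sSup_fgBelow hE))

theorem sSup_fgBelow_smul_le (s : SemistarOperation D K) {x : K} (hx : x ≠ 0)
    {E : Submodule D K} (hE : E ≠ ⊥) :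
    x • sSup (s '' fgBelow E) ≤ sSup (s '' fgBelow (x • E)) := by
  rintro _ ⟨y, hy, rfl⟩
  obtain ⟨F, h0, h1, h2, hyF⟩ := (s.mem_sSup_fgBelow hE).mp hy
  refine (s.mem_sSup_fgBelow (smul_ne_bot hx hE)).mpr
    ⟨x • F, smul_ne_bot hx h0, fg_smul x h1, Submodule.map_mono h2, ?_⟩
  rw [s.map_smul' x F hx h0]
  exact Submodule.smul_mem_pointwise_smul y x _ hyF

/-- The finite-type semistar operation `⋆_f` associated with `⋆`: `E^{⋆_f}` is the union of the
`F^⋆`, where `F` runs through the nonzero finitely generated submodules of `E`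
(see `mem_sSup_fgBelow`). -/
def finiteType (s : SemistarOperation D K) : SemistarOperation D K where
  toFun E := sSup (s '' fgBelow E)
  map_smul' x E hx hE := by
    refine le_antisymm ?_ (s.sSup_fgBelow_smul_le hx hE)
    have h := s.sSup_fgBelow_smul_le (inv_ne_zero hx) (smul_ne_bot hx hE)
    rw [inv_smul_smul₀ hx] at h
    have h' : x • x⁻¹ • sSup (s '' fgBelow (x • E)) ≤ x • sSup (s '' fgBelow E) :=
      Submodule.map_mono h
    rwa [smul_inv_smul₀ hx] at h'
  mono' E F hE hF hEF := by
    apply sSup_le_sSup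
    rintro _ ⟨G, ⟨h0, h1, h2⟩, rfl⟩
    exact ⟨G, ⟨h0, h1, h2.trans hEF⟩, rfl⟩
  le_map' E hE := s.le_sSup_fgBelow hE
  idem' E hE := by
    refine le_antisymm ?_ (s.le_sSup_fgBelow (s.sSup_fgBelow_ne_bot hE))
    apply sSup_le
    rintro _ ⟨F, ⟨h0, h1, h2⟩, rfl⟩
    obtain ⟨_, ⟨G, hG, rfl⟩, hFG⟩ :=
      ((CompleteLattice.isCompactElement_iff_le_of_directed_sSup_le _ _).mp
        ((Submodule.fg_iff_compact F).mp h1)) _ ((fgBelow_nonempty hE).image _)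
        (s.directedOn_fgBelow E) h2
    calc s F ≤ s (s G) := s.mono' _ _ h0 (s.map_ne_bot hG.1) hFG
      _ = s G := s.idem' G hG.1
      _ ≤ sSup (s '' fgBelow E) := le_sSup (Set.mem_image_of_mem _ hG)

/-- A nonzero ideal `I` of `D` with `I = I^⋆ ∩ D`. -/
def IsQuasiIdeal (s : SemistarOperation D K) (I : Ideal D) : Prop :=
  I ≠ ⊥ ∧ ∀ a : D, algebraMap D K a ∈ s (IsLocalization.coeSubmodule K I) ↔ a ∈ I

/-- A quasi-`⋆`-maximal ideal: maximal in the set of all proper quasi-`⋆`-ideals. -/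
def IsQuasiMaximal (s : SemistarOperation D K) (M : Ideal D) : Prop :=
  Maximal (fun I : Ideal D => s.IsQuasiIdeal I ∧ I ≠ ⊤) M

/-- The localization `D_P` of `D` at a prime ideal `P`, as a subset of `K`: all quotients `a / b`
with `a ∈ D` and `b ∈ D \ P`. -/
def localizationAt (K : Type*) [Field K] [Algebra D K] (P : Ideal D) : Set K :=
  {x | ∃ a b : D, b ∉ P ∧ x = algebraMap D K a / algebraMap D K b}

/-- `∇^⋆(P)`: the quasi-`⋆`-maximal ideals that do not contain `P`. -/
def nabla (s : SemistarOperation D K) (P : Ideal D) : Set (Ideal D) :=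
  {M | s.IsQuasiMaximal M ∧ ¬ P ≤ M}

/-- `Θ^⋆(P)`: the intersection in `K` of the `D_M` with `M ∈ ∇^⋆(P)` (equal to `K` when there is
no such `M`). -/
def theta (s : SemistarOperation D K) (P : Ideal D) : Set K :=
  ⋂ M ∈ s.nabla P, localizationAt K M

/-- `P` is `⋆`-sharp if `Θ^⋆(P)` is not contained in `D_P`. -/
def IsSharpAt (s : SemistarOperation D K) (P : Ideal D) : Prop :=
  ¬ s.theta P ⊆ localizationAt K P

/-- `D` is `⋆`-sharp if each quasi-`⋆`-maximal ideal of `D` is `⋆`-sharp. (Used for finite-type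
operations.) -/
def IsSharp (s : SemistarOperation D K) : Prop :=
  ∀ P : Ideal D, s.IsQuasiMaximal P → s.IsSharpAt P

/-- `E` is `⋆`-idempotent if `E^⋆ = (E^2)^⋆`. -/
def IsIdempotent (s : SemistarOperation D K) (E : Submodule D K) : Prop :=
  s E = s (E ^ 2)

/-- `D` is a Prüfer `⋆`-multiplication domain: `(F F⁻¹)^{⋆_f} = D^{⋆_f}` for every nonzero finitely
generated `D`-submodule `F` of `K`. Here `1 : Submodule D K` is `D` itself, and
`1 / F` is `F⁻¹ = (D : F)`. -/
def IsPStarMD (s : SemistarOperation D K) : Prop :=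
  ∀ F : Submodule D K, F ≠ ⊥ → F.FG → s.finiteType (F * (1 / F)) = s.finiteType 1

/-- `E ⊆ (D : (D : E))`. -/
theorem le_one_div_one_div (E : Submodule D K) : E ≤ 1 / (1 / E) := by
  intro x hx
  rw [Submodule.mem_div_iff_forall_mul_mem]
  intro y hy
  rw [mul_comm]
  exact Submodule.mem_div_iff_forall_mul_mem.mp hy x hx

theorem one_div_anti {E F : Submodule D K} (h : E ≤ F) : 1 / F ≤ 1 / E := by
  intro x hx
  rw [Submodule.mem_div_iff_forall_mul_mem] at hx ⊢
  exact fun y hy => hx y (h hy)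

theorem one_div_smul {x : K} (hx : x ≠ 0) (E : Submodule D K) : 1 / (x • E) = x⁻¹ • (1 / E) := by
  ext y
  rw [Submodule.mem_div_iff_forall_mul_mem]
  constructor
  · intro h
    refine ⟨x * y, ?_, by simp [hx]⟩
    refine Submodule.mem_div_iff_forall_mul_mem.mpr fun z hz => ?_
    have := h (x • z) (Submodule.smul_mem_pointwise_smul z x E hz)
    rwa [smul_eq_mul, ← mul_assoc, mul_comm y x] at this
  · rintro ⟨z, hz, rfl⟩ _ ⟨w, hw, rfl⟩
    have := Submodule.mem_div_iff_forall_mul_mem.mp hz w hw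
    have e : (x⁻¹ * z) * (x * w) = z * w := by field_simp
    simpa [e] using this

/-- The `v`-operation `E ↦ E^v = (E⁻¹)⁻¹ = (D : (D : E))`; a nonzero submodule `E` that is not a
fractional ideal has `(D : E) = 0` and hence `E^v = K`. -/
def vOperation (D K : Type*) [CommRing D] [Field K] [Algebra D K] : SemistarOperation D K where
  toFun E := 1 / (1 / E)
  map_smul' x E hx _ := by
    rw [one_div_smul hx, one_div_smul (inv_ne_zero hx), inv_inv]
  mono' _ _ _ _ h := one_div_anti (one_div_anti h)
  le_map' E _ := le_one_div_one_div E
  idem' E _ := le_antisymm (one_div_anti (le_one_div_one_div (1 / E))) (le_one_div_one_div _)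

/-- The `t`-operation: the finite-type operation associated with `v`. -/
def tOperation (D K : Type*) [CommRing D] [Field K] [Algebra D K] : SemistarOperation D K :=
  (vOperation D K).finiteType

/-- `D` is a P`v`MD: each nonzero finitely generated ideal `I` of `D` is `t`-invertible, that is,
`(I I⁻¹)^t = D`. -/
def IsPvMD (D K : Type*) [CommRing D] [Field K] [Algebra D K] : Prop :=
  ∀ I : Ideal D, I ≠ ⊥ → I.FG →
    tOperation D K (IsLocalization.coeSubmodule K I * (1 / IsLocalization.coeSubmodule K I)) = 1

end

end SemistarOperation

/-!
For a quasi-`⋆_f`-maximal ideal `M` of a P`⋆`MD the ring `D_M` is a valuation ring containing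
`D^⋆`, and membership in `E^{⋆_f}` may be tested at all such `M` in turn. Over a valuation ring `V`
with quotient field `K`, a module `E ⊆ K` with `(V : E) ⊆ V` satisfies `E ⊆ E²`, so it suffices
that `(D^⋆ : E) = D^⋆` passes to `V = D_M`. This is where sharpness enters: an element of
`(V : E)` outside `V` has a `V`-multiple outside `V` that lies in all the other localizations,
and such a multiple belongs to `(D^⋆ : E) = D^⋆ ⊆ V`.
-/

namespace SemistarOperation

open IsLocalization

theorem le_pow_two_of_one_div_le_one {V K : Type*} [CommRing V] [IsDomain V] [ValuationRing V]
    [Field K] [Algebra V K] [IsFractionRing V K] {E : Submodule V K} (hE : 1 / E ≤ 1) :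
    E ≤ E ^ 2 := by
  intro x hx
  rw [pow_two]
  rcases eq_or_ne x 0 with rfl | hx0
  · exact zero_mem _
  by_cases hinv : x⁻¹ ∈ 1 / E
  · obtain ⟨c, hc⟩ := Submodule.mem_one.mp (hE hinv)
    have hxc : x = c • (x * x) := by rw [Algebra.smul_def, hc, inv_mul_cancel_left₀ hx0]
    exact hxc ▸ Submodule.smul_mem _ c (Submodule.mul_mem_mul hx hx)
  · obtain ⟨a, ha, hxa⟩ : ∃ a ∈ E, x⁻¹ * a ∉ (1 : Submodule V K) := by
      simpa [Submodule.mem_div_iff_forall_mul_mem] using hinv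
    obtain ⟨b, hb, hxab⟩ : ∃ b ∈ E, x⁻¹ * a * b ∉ (1 : Submodule V K) := by
      simpa [Submodule.mem_div_iff_forall_mul_mem] using fun h => hxa (hE h)
    have hab0 : a * b ≠ 0 := fun h => hxab (by simp [mul_assoc, h])
    obtain ⟨c, hc⟩ := (ValuationRing.isInteger_or_isInteger V (x⁻¹ * a * b)).resolve_left
      fun h => hxab (Submodule.mem_one.mpr h)
    have hxc : x = c • (a * b) := by
      rw [Algebra.smul_def, hc, mul_assoc, mul_inv, inv_inv, inv_mul_cancel_right₀ hab0]
    exact hxc ▸ Submodule.smul_mem _ c (Submodule.mul_mem_mul ha hb)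

section

variable {D K : Type*} [CommRing D] [Field K] [Algebra D K]

theorem map_le_map_of_le_map (s : SemistarOperation D K) {E F : Submodule D K} (hE : E ≠ ⊥)
    (hF : F ≠ ⊥) (h : E ≤ s F) : s E ≤ s F :=
  (s.mono' E (s F) hE (s.map_ne_bot hF) h).trans_eq (s.idem' F hF)

theorem mul_mem_map_of_smul_le (s : SemistarOperation D K) {E F : Submodule D K} (hE : E ≠ ⊥)
    (hF : F ≠ ⊥) {x y : K} (h : x • E ≤ F) (hy : y ∈ s E) : x * y ∈ s F := by
  rcases eq_or_ne x 0 with rfl | hx0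
  · simp
  · refine s.mono' _ _ (smul_ne_bot hx0 hE) hF h ?_
    rw [s.map_smul' x E hx0 hE]
    exact Submodule.smul_mem_pointwise_smul y x _ hy

theorem mul_mem_map_of_mem_of_mem_map_one (s : SemistarOperation D K) {E : Submodule D K}
    (hE : E ≠ ⊥) {x y : K} (hx : x ∈ E) (hy : y ∈ s 1) : x * y ∈ s E := by
  refine s.mul_mem_map_of_smul_le one_ne_zero hE ?_ hy
  rwa [← Submodule.span_singleton_mul, mul_one, Submodule.span_singleton_le_iff_mem]

theorem le_map_one_of_map_one_div_eq {s : SemistarOperation D K} {E : Submodule D K}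
    (hE : s 1 / E = s 1) : E ≤ s 1 :=
  Submodule.one_mem_div.mp <| hE.symm ▸ s.le_map' 1 one_ne_zero (Submodule.one_le.mp le_rfl)

theorem finiteType_one (s : SemistarOperation D K) : s.finiteType 1 = s 1 := by
  refine le_antisymm (sSup_le ?_) (le_sSup ⟨1, ⟨one_ne_zero, ?_, le_rfl⟩, rfl⟩)
  · rintro _ ⟨F, ⟨hF0, -, hF⟩, rfl⟩
    exact s.mono' F 1 hF0 one_ne_zero hF
  · exact Submodule.one_eq_span (R := D) (A := K) ▸ Submodule.fg_span_singleton 1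

theorem exists_mem_finiteType_of_mem_finiteType_sSup (s : SemistarOperation D K)
    {c : Set (Submodule D K)} (hne : c.Nonempty) (hdir : DirectedOn (· ≤ ·) c)
    (hc : ∀ E ∈ c, E ≠ ⊥) {x : K} (hx : x ∈ s.finiteType (sSup c)) :
    ∃ E ∈ c, x ∈ s.finiteType E := by
  have hsup : sSup c ≠ ⊥ :=
    let ⟨E, hE⟩ := hne
    ne_bot_of_le_ne_bot (hc E hE) (le_sSup hE)
  obtain ⟨F, hF0, hF, hle, hxF⟩ := (s.mem_sSup_fgBelow hsup).mp hx
  obtain ⟨E, hE, hFE⟩ := (CompleteLattice.isCompactElement_iff_le_of_directed_sSup_le _ F).mp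
    ((Submodule.fg_iff_compact F).mp hF) c hne hdir hle
  exact ⟨E, hE, (s.mem_sSup_fgBelow (hc E hE)).mpr ⟨F, hF0, hF, hFE, hxF⟩⟩

theorem coeSubmodule_sSup (c : Set (Ideal D)) :
    coeSubmodule K (sSup c) = sSup (coeSubmodule K '' c) := by
  rw [sSup_image]
  simp only [coeSubmodule, sSup_eq_iSup, Submodule.map_iSup]

theorem exists_smul_mem_one_of_mem_localizationAt {M : Ideal D} {x : K}
    (hx : x ∈ localizationAt K M) : ∃ b ∉ M, b • x ∈ (1 : Submodule D K) := by
  obtain ⟨a, b, hb, rfl⟩ := hx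
  rcases eq_or_ne (algebraMap D K b) 0 with hb0 | hb0
  · exact ⟨b, hb, by simp [hb0]⟩
  · exact ⟨b, hb, Submodule.mem_one.mpr
      ⟨a, by rw [Algebra.smul_def, mul_div_cancel₀ _ hb0]⟩⟩

/-- The ideal `I^⋆ ∩ D` of `D`; for `I ≠ 0` it is the smallest quasi-`⋆`-ideal containing `I`. -/
def quasiClosure (s : SemistarOperation D K) (I : Ideal D) : Ideal D :=
  (s (coeSubmodule K I)).comap (Algebra.linearMap D K)

theorem mem_quasiClosure {s : SemistarOperation D K} {I : Ideal D} {a : D} :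
    a ∈ s.quasiClosure I ↔ algebraMap D K a ∈ s (coeSubmodule K I) :=
  Iff.rfl

theorem coeSubmodule_quasiClosure_le (s : SemistarOperation D K) (I : Ideal D) :
    coeSubmodule K (s.quasiClosure I) ≤ s (coeSubmodule K I) :=
  Submodule.map_comap_le _ _

theorem IsQuasiIdeal.one_mem_map_iff {s : SemistarOperation D K} {I : Ideal D}
    (hI : s.IsQuasiIdeal I) : (1 : K) ∈ s (coeSubmodule K I) ↔ I = ⊤ := by
  rw [Ideal.eq_top_iff_one, ← hI.2, map_one]

theorem one_div_one : (1 : Submodule D K) / 1 = 1 :=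
  le_antisymm ((one_mul _).symm.trans_le Submodule.mul_one_div_le_one)
    (Submodule.one_le_one_div.mpr le_rfl)

theorem vOperation_one : vOperation D K 1 = 1 :=
  (congrArg (1 / ·) one_div_one).trans one_div_one

theorem smul_mul_one_div_smul {x : K} (hx : x ≠ 0) (F : Submodule D K) :
    (x • F) * (1 / (x • F)) = F * (1 / F) := by
  rw [one_div_smul hx, smul_mul_smul_comm, mul_inv_cancel₀ hx, one_smul]

end

section

variable {D K : Type*} [CommRing D] [Field K] [Algebra D K] [FaithfulSMul D K]

theorem algebraMap_mem_coeSubmodule {I : Ideal D} {a : D} :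
    algebraMap D K a ∈ coeSubmodule K I ↔ a ∈ I :=
  (FaithfulSMul.algebraMap_injective D K).mem_set_image

theorem coeSubmodule_ne_bot {I : Ideal D} (hI : I ≠ ⊥) : coeSubmodule K I ≠ ⊥ := by
  obtain ⟨a, ha, ha0⟩ := (Submodule.ne_bot_iff I).mp hI
  exact (Submodule.ne_bot_iff _).mpr
    ⟨algebraMap D K a, algebraMap_mem_coeSubmodule.mpr ha, by simpa using ha0⟩

theorem algebraMap_ne_zero_of_notMem {M : Ideal D} {b : D} (hb : b ∉ M) : algebraMap D K b ≠ 0 :=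
  (map_ne_zero_iff _ (FaithfulSMul.algebraMap_injective D K)).mpr
    (ne_of_mem_of_not_mem M.zero_mem hb).symm

theorem le_quasiClosure (s : SemistarOperation D K) {I : Ideal D} (hI : I ≠ ⊥) :
    I ≤ s.quasiClosure I := fun _ ha =>
  s.le_map' _ (coeSubmodule_ne_bot hI) (algebraMap_mem_coeSubmodule.mpr ha)

theorem quasiClosure_ne_bot (s : SemistarOperation D K) {I : Ideal D} (hI : I ≠ ⊥) :
    s.quasiClosure I ≠ ⊥ :=
  ne_bot_of_le_ne_bot hI (s.le_quasiClosure hI)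

theorem map_quasiClosure (s : SemistarOperation D K) {I : Ideal D} (hI : I ≠ ⊥) :
    s (coeSubmodule K (s.quasiClosure I)) = s (coeSubmodule K I) := by
  have hI0 := coeSubmodule_ne_bot (K := K) hI
  have hcl := coeSubmodule_ne_bot (K := K) (s.quasiClosure_ne_bot hI)
  exact le_antisymm (s.map_le_map_of_le_map hcl hI0 (s.coeSubmodule_quasiClosure_le I))
    (s.mono' _ _ hI0 hcl (coeSubmodule_mono K (s.le_quasiClosure hI)))

theorem isQuasiIdeal_quasiClosure (s : SemistarOperation D K) {I : Ideal D} (hI : I ≠ ⊥) :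
    s.IsQuasiIdeal (s.quasiClosure I) :=
  ⟨s.quasiClosure_ne_bot hI, fun a => by rw [s.map_quasiClosure hI, mem_quasiClosure]⟩

theorem isQuasiMaximal_iff_maximal_one_notMem_map {s : SemistarOperation D K} {M : Ideal D} :
    s.IsQuasiMaximal M ↔ Maximal (fun I => I ≠ ⊥ ∧ (1 : K) ∉ s (coeSubmodule K I)) M := by
  constructor
  · rintro ⟨⟨hM, hMtop⟩, hmax⟩
    refine ⟨⟨hM.1, mt hM.one_mem_map_iff.mp hMtop⟩, fun I ⟨hI0, hI⟩ hMI => ?_⟩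
    have hcl := s.isQuasiIdeal_quasiClosure hI0
    have hcl_top : s.quasiClosure I ≠ ⊤ := by
      rwa [Ne, ← hcl.one_mem_map_iff, s.map_quasiClosure hI0]
    have hle := s.le_quasiClosure hI0
    exact hle.trans (hmax ⟨hcl, hcl_top⟩ (hMI.trans hle))
  · rintro ⟨⟨hM0, hM⟩, hmax⟩
    have hcl_eq : s.quasiClosure M = M := le_antisymm
      (hmax ⟨s.quasiClosure_ne_bot hM0, by rwa [s.map_quasiClosure hM0]⟩ (s.le_quasiClosure hM0))
      (s.le_quasiClosure hM0)
    have hMq : s.IsQuasiIdeal M := hcl_eq ▸ s.isQuasiIdeal_quasiClosure hM0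
    exact ⟨⟨hMq, mt hMq.one_mem_map_iff.mpr hM⟩, fun I ⟨hI, hItop⟩ =>
      hmax ⟨hI.1, mt hI.one_mem_map_iff.mp hItop⟩⟩

theorem IsQuasiMaximal.isPrime {s : SemistarOperation D K} {M : Ideal D}
    (hM : s.IsQuasiMaximal M) : M.IsPrime := by
  refine ⟨hM.prop.2, fun {a b} hab => or_iff_not_imp_left.mpr fun ha => ?_⟩
  have hlt : M < M ⊔ Ideal.span {a} := by simpa using ha
  have hne : M ⊔ Ideal.span {a} ≠ ⊥ := (bot_le.trans_lt hlt).ne'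
  have hone : (1 : K) ∈ s (coeSubmodule K (M ⊔ Ideal.span {a})) := by
    by_contra h1
    exact (isQuasiMaximal_iff_maximal_one_notMem_map.mp hM).not_prop_of_gt hlt ⟨hne, h1⟩
  have hle : Ideal.span {b} * (M ⊔ Ideal.span {a}) ≤ M := by
    rw [Ideal.mul_sup, Ideal.span_singleton_mul_span_singleton, mul_comm b a]
    exact sup_le Ideal.mul_le_right ((Ideal.span_singleton_le_iff_mem M).mpr hab)
  have hsmul : algebraMap D K b • coeSubmodule K (M ⊔ Ideal.span {a}) ≤ coeSubmodule K M := by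
    rw [← Submodule.span_singleton_mul, ← coeSubmodule_span_singleton, ← coeSubmodule_mul]
    exact coeSubmodule_mono K hle
  rw [← hM.prop.1.2 b, ← mul_one (algebraMap D K b)]
  exact s.mul_mem_map_of_smul_le (coeSubmodule_ne_bot hne) (coeSubmodule_ne_bot hM.prop.1.1)
    hsmul hone

theorem exists_isQuasiMaximal_ge (s : SemistarOperation D K) {J : Ideal D} (hJ : J ≠ ⊥)
    (h1 : (1 : K) ∉ s.finiteType (coeSubmodule K J)) :
    ∃ M, s.finiteType.IsQuasiMaximal M ∧ J ≤ M := by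
  let S : Set (Ideal D) := {I | I ≠ ⊥ ∧ (1 : K) ∉ s.finiteType (coeSubmodule K I)}
  have hchain : ∀ c ⊆ S, IsChain (· ≤ ·) c → ∀ I ∈ c, sSup c ∈ S := by
    intro c hcs hc I hI
    refine ⟨ne_bot_of_le_ne_bot (hcs hI).1 (le_sSup hI), fun hone => ?_⟩
    rw [coeSubmodule_sSup] at hone
    have hdir : DirectedOn (· ≤ ·) (coeSubmodule K '' c) :=
      directedOn_image.mpr (hc.directedOn.mono fun _ _ h => coeSubmodule_mono K h)
    have hne_bot : ∀ E ∈ coeSubmodule K '' c, E ≠ ⊥ :=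
      Set.forall_mem_image.mpr fun L hL => coeSubmodule_ne_bot (hcs hL).1
    obtain ⟨_, ⟨L, hL, rfl⟩, hL1⟩ := s.exists_mem_finiteType_of_mem_finiteType_sSup
      (Set.Nonempty.image _ ⟨I, hI⟩) hdir hne_bot hone
    exact (hcs hL).2 hL1
  obtain ⟨M, hJM, hM⟩ := zorn_le_nonempty₀ S
    (fun c hcs hc I hI => ⟨sSup c, hchain c hcs hc I hI, fun _ => le_sSup⟩) J ⟨hJ, h1⟩
  exact ⟨M, isQuasiMaximal_iff_maximal_one_notMem_map.mpr hM, hJM⟩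

end

section

variable {D K : Type*} [CommRing D] [Field K] [Algebra D K] [IsFractionRing D K]

theorem exists_smul_mem (x : K) {E : Submodule D K} (hE : E ≠ ⊥) : ∃ d : D, d ≠ 0 ∧ d • x ∈ E := by
  rcases eq_or_ne x 0 with rfl | hx0
  · have := (algebraMap D K).domain_nontrivial
    exact ⟨1, one_ne_zero, by simp⟩
  obtain ⟨e, he, he0⟩ := (Submodule.ne_bot_iff E).mp hE
  obtain ⟨a, b, hb, hab⟩ := IsFractionRing.div_surjective D (e / x)
  have hb0 : algebraMap D K b ≠ 0 :=
    (map_units K (⟨b, hb⟩ : nonZeroDivisors D)).ne_zero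
  have hsmul : a • x = b • e := by
    rw [Algebra.smul_def, Algebra.smul_def, mul_comm _ e]
    exact (div_eq_div_iff hb0 hx0).mp hab
  refine ⟨a, ?_, hsmul ▸ E.smul_mem b he⟩
  rintro rfl
  rw [map_zero, zero_div] at hab
  exact div_ne_zero he0 hx0 hab.symm

theorem exists_smul_eq_coeSubmodule {F : Submodule D K} (hF : F.FG) :
    ∃ x : K, x ≠ 0 ∧ ∃ I : Ideal D, x • F = coeSubmodule K I := by
  let J : FractionalIdeal (nonZeroDivisors D) K := ⟨F, FractionalIdeal.isFractional_of_fg hF⟩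
  refine ⟨algebraMap D K J.den, (map_units K J.den).ne_zero, J.num,
    Eq.trans ?_ J.den_mul_self_eq_num⟩
  ext y
  simp only [Submodule.mem_smul_pointwise_iff_exists, Submonoid.smul_def, Algebra.smul_def]
  rfl

theorem one_div_ne_bot_of_fg {F : Submodule D K} (hF : F.FG) : 1 / F ≠ ⊥ := by
  obtain ⟨x, hx0, I, hI⟩ := exists_smul_eq_coeSubmodule hF
  refine (Submodule.ne_bot_iff _).mpr
    ⟨x, Submodule.mem_div_iff_forall_mul_mem.mpr fun y hy => ?_, hx0⟩
  have hxy : x * y ∈ coeSubmodule K I := hI ▸ Submodule.smul_mem_pointwise_smul y x F hy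
  exact coeSubmodule_top (R := D) K ▸ coeSubmodule_mono K le_top hxy

theorem mem_finiteType_of_forall_isQuasiMaximal (s : SemistarOperation D K) {E : Submodule D K}
    (hE : E ≠ ⊥) {x : K}
    (h : ∀ M : Ideal D, s.finiteType.IsQuasiMaximal M → ∃ b ∉ M, b • x ∈ E) :
    x ∈ s.finiteType E := by
  let J : Ideal D := E.comap (LinearMap.toSpanSingleton D K x)
  have hJ : J ≠ ⊥ := by
    obtain ⟨d, hd0, hd⟩ := exists_smul_mem x hE
    exact (Submodule.ne_bot_iff J).mpr ⟨d, hd, hd0⟩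
  have hone : (1 : K) ∈ s.finiteType (coeSubmodule K J) := by
    by_contra h1
    obtain ⟨M, hM, hJM⟩ := s.exists_isQuasiMaximal_ge hJ h1
    obtain ⟨b, hb, hbx⟩ := h M hM
    exact hb (hJM hbx)
  have hle : x • coeSubmodule K J ≤ E := by
    rintro _ ⟨_, ⟨j, hj, rfl⟩, rfl⟩
    have hjx : j • x ∈ E := hj
    rwa [Algebra.smul_def, mul_comm] at hjx
  simpa using s.finiteType.mul_mem_map_of_smul_le (coeSubmodule_ne_bot hJ) hE hle hone

theorem iInter_localizationAt_subset_map_one (s : SemistarOperation D K) :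
    ⋂ M ∈ {M : Ideal D | s.finiteType.IsQuasiMaximal M}, localizationAt K M ⊆ s 1 := by
  intro x hx
  rw [SetLike.mem_coe, ← s.finiteType_one]
  exact s.mem_finiteType_of_forall_isQuasiMaximal one_ne_zero fun M hM =>
    exists_smul_mem_one_of_mem_localizationAt (Set.mem_iInter₂.mp hx M hM)

theorem IsPStarMD.exists_forall_div_mem_localizationAt {s : SemistarOperation D K}
    (hP : s.IsPStarMD) {M : Ideal D} (hM : s.finiteType.IsQuasiMaximal M) {T : Set K}
    (hT : T.Finite) (hT0 : Submodule.span D T ≠ ⊥) :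
    ∃ t ∈ T, ∀ u ∈ T, u / t ∈ localizationAt K M := by
  set F := Submodule.span D T
  have hF : F.FG := Submodule.fg_span hT
  have hnot_le : ¬ F * (1 / F) ≤ coeSubmodule K M := fun hle =>
    (isQuasiMaximal_iff_maximal_one_notMem_map.mp hM).prop.2 <|
      s.finiteType.mono' _ _ (mul_ne_zero hT0 (one_div_ne_bot_of_fg hF))
        (coeSubmodule_ne_bot hM.prop.1.1) hle <|
      hP F hT0 hF ▸ s.finiteType.le_map' 1 one_ne_zero (Submodule.one_le.mp le_rfl)
  rw [← Submodule.le_div_iff_mul_le, Submodule.span_le, Set.not_subset] at hnot_le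
  obtain ⟨t, ht, htM⟩ := hnot_le
  obtain ⟨g, hg, htg⟩ : ∃ g ∈ 1 / F, t * g ∉ coeSubmodule K M := by
    simpa [Submodule.mem_div_iff_forall_mul_mem] using htM
  have hmul_g : ∀ u ∈ T, ∃ a, algebraMap D K a = u * g := fun u hu =>
    Submodule.mem_one.mp <| mul_comm g u ▸
      Submodule.mem_div_iff_forall_mul_mem.mp hg u (Submodule.subset_span hu)
  obtain ⟨b, hb⟩ := hmul_g t ht
  have hbM : b ∉ M := by rwa [← hb, algebraMap_mem_coeSubmodule] at htg
  have hg0 : g ≠ 0 :=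
    right_ne_zero_of_mul (hb ▸ algebraMap_ne_zero_of_notMem (K := K) hbM)
  refine ⟨t, ht, fun u hu => ?_⟩
  obtain ⟨a, ha⟩ := hmul_g u hu
  exact ⟨a, b, hbM, by rw [ha, hb, mul_div_mul_right _ _ hg0]⟩

theorem IsPStarMD.mem_or_inv_mem_localizationAt {s : SemistarOperation D K} (hP : s.IsPStarMD)
    {M : Ideal D} (hM : s.finiteType.IsQuasiMaximal M) (x : K) :
    x ∈ localizationAt K M ∨ x⁻¹ ∈ localizationAt K M := by
  have hne : Submodule.span D {1, x} ≠ ⊥ :=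
    (Submodule.ne_bot_iff _).mpr ⟨1, Submodule.subset_span (by simp), one_ne_zero⟩
  obtain ⟨t, ht, hdiv⟩ := hP.exists_forall_div_mem_localizationAt hM (Set.toFinite {1, x}) hne
  rcases ht with rfl | rfl
  · exact .inl (by simpa using hdiv x (by simp))
  · exact .inr (by simpa using hdiv 1 (by simp))

theorem IsPStarMD.map_one_subset_localizationAt {s : SemistarOperation D K} (hP : s.IsPStarMD)
    {M : Ideal D} (hM : s.finiteType.IsQuasiMaximal M) : (s 1 : Set K) ⊆ localizationAt K M := by
  intro x hx
  by_contra hxM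
  obtain ⟨a, b, hb, hab⟩ := (hP.mem_or_inv_mem_localizationAt hM x).resolve_left hxM
  have ha : a ∈ M := by
    by_contra ha
    exact hxM ⟨b, a, ha, by rw [← inv_div, ← hab, inv_inv]⟩
  have hx0 : x ≠ 0 := by
    rintro rfl
    have := hM.isPrime
    exact hxM ⟨0, 1, Ideal.one_notMem M, by simp⟩
  have hbx : algebraMap D K b = algebraMap D K a * x := by
    rw [eq_div_iff (algebraMap_ne_zero_of_notMem hb)] at hab
    rw [← hab, mul_right_comm, inv_mul_cancel₀ hx0, one_mul]
  refine hb ((hM.prop.1.2 b).mp (hbx ▸ ?_))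
  exact s.finiteType.mul_mem_map_of_mem_of_mem_map_one (coeSubmodule_ne_bot hM.prop.1.1)
    (algebraMap_mem_coeSubmodule.mpr ha) (s.finiteType_one ▸ hx)

theorem IsPvMD.isPStarMD (h : IsPvMD D K) : (vOperation D K).IsPStarMD := by
  intro F hF0 hF
  obtain ⟨x, hx0, I, hI⟩ := exists_smul_eq_coeSubmodule hF
  have hI0 : I ≠ ⊥ := by
    rintro rfl
    exact smul_ne_bot hx0 hF0 (hI.trans (coeSubmodule_bot K))
  have hIfg : I.FG :=
    (coeSubmodule_fg K (IsFractionRing.injective D K) I).mp (hI ▸ fg_smul x hF)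
  rw [finiteType_one, vOperation_one, ← smul_mul_one_div_smul hx0 F, hI]
  exact h I hI0 hIfg

end

section

variable {D K : Type*} [CommRing D] [IsDomain D] [Field K] [Algebra D K] [IsFractionRing D K]

variable (K) in
/-- The localization `D_M` at a prime ideal `M` as a subalgebra of `K`. It has the same elements as
`localizationAt K M`, and gives access to the library's theory of localizations and valuation
rings. -/
noncomputable abbrev localSubalgebra (M : Ideal D) [M.IsPrime] : Subalgebra D K :=
  Localization.subalgebra.ofField K M.primeCompl M.primeCompl_le_nonZeroDivisors

theorem mem_localSubalgebra {M : Ideal D} [M.IsPrime] {x : K} :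
    x ∈ localSubalgebra K M ↔ x ∈ localizationAt K M := by
  constructor
  · rintro ⟨a, b, hb, rfl⟩
    exact ⟨a, b, hb, div_eq_mul_inv _ _ |>.symm⟩
  · rintro ⟨a, b, hb, rfl⟩
    exact ⟨a, b, hb, div_eq_mul_inv _ _⟩

theorem IsPStarMD.valuationRing_localSubalgebra {s : SemistarOperation D K} (hP : s.IsPStarMD)
    {M : Ideal D} [M.IsPrime] (hM : s.finiteType.IsQuasiMaximal M) :
    ValuationRing (localSubalgebra K M) := by
  rw [ValuationRing.iff_isInteger_or_isInteger _ K]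
  exact fun x => (hP.mem_or_inv_mem_localizationAt hM x).imp
    (fun h => ⟨⟨x, mem_localSubalgebra.mpr h⟩, rfl⟩)
    (fun h => ⟨⟨x⁻¹, mem_localSubalgebra.mpr h⟩, rfl⟩)

theorem smul_mem_theta (s : SemistarOperation D K) {P : Ideal D} (a : D) {x : K}
    (hx : x ∈ s.theta P) : a • x ∈ s.theta P := by
  refine Set.mem_iInter₂.mpr fun N hN => ?_
  have := hN.1.isPrime
  exact mem_localSubalgebra.mp
    ((localSubalgebra K N).smul_mem (mem_localSubalgebra.mpr (Set.mem_iInter₂.mp hx N hN)) a)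

theorem IsSharpAt.exists_mul_mem_theta {s : SemistarOperation D K} {M : Ideal D} [M.IsPrime]
    (hsharp : s.IsSharpAt M)
    (hval : ∀ x : K, x ∈ localizationAt K M ∨ x⁻¹ ∈ localizationAt K M) {z : K}
    (hz : z ∉ localSubalgebra K M) :
    ∃ c ∈ localSubalgebra K M, c * z ∈ s.theta M ∧ c * z ∉ localSubalgebra K M := by
  obtain ⟨u, hu, huM⟩ := Set.not_subset.mp hsharp
  rw [← mem_localSubalgebra] at huM
  have hz0 : z ≠ 0 := ne_of_mem_of_not_mem (zero_mem _) hz |>.symm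
  have hu0 : u ≠ 0 := ne_of_mem_of_not_mem (zero_mem _) huM |>.symm
  rcases hval (u / z) with h | ⟨a, b, hb, hab⟩
  · refine ⟨u / z, mem_localSubalgebra.mpr h, ?_⟩
    rw [div_mul_cancel₀ u hz0]
    exact ⟨hu, huM⟩
  · have hb0 := algebraMap_ne_zero_of_notMem (K := K) hb
    have hbz : algebraMap D K b * z = a • u := by
      rw [inv_div, div_eq_div_iff hu0 hb0] at hab
      rw [Algebra.smul_def, ← hab, mul_comm]
    refine ⟨algebraMap D K b, Subalgebra.algebraMap_mem _ b, ?_, fun h => hz ?_⟩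
    · exact hbz ▸ s.smul_mem_theta a hu
    · have hinv : (algebraMap D K b)⁻¹ ∈ localSubalgebra K M :=
        mem_localSubalgebra.mpr ⟨1, b, hb, by simp⟩
      simpa [inv_mul_cancel_left₀ hb0] using mul_mem hinv h

theorem IsPStarMD.mem_map_one_div_of_mem_theta {s : SemistarOperation D K} (hP : s.IsPStarMD)
    {M : Ideal D} (hM : s.finiteType.IsQuasiMaximal M) {E : Submodule D K} (hE : E ≤ s 1) {y : K}
    (hy : y ∈ s.finiteType.theta M) (hyE : ∀ e ∈ E, y * e ∈ localizationAt K M) :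
    y ∈ s 1 / E := by
  refine Submodule.mem_div_iff_forall_mul_mem.mpr fun e he =>
    s.iInter_localizationAt_subset_map_one (Set.mem_iInter₂.mpr fun N hN => ?_)
  by_cases hMN : M ≤ N
  · rw [← hM.eq_of_le hN.1 hMN]
    exact hyE e he
  · have hNmax : s.finiteType.IsQuasiMaximal N := hN
    have := hNmax.isPrime
    have heN := hP.map_one_subset_localizationAt hN (hE he)
    exact mem_localSubalgebra.mp (mul_mem
      (mem_localSubalgebra.mpr (Set.mem_iInter₂.mp hy N ⟨hN, hMN⟩))
      (mem_localSubalgebra.mpr heN))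

theorem IsPStarMD.one_div_span_localSubalgebra_le_one {s : SemistarOperation D K}
    (hP : s.IsPStarMD) {M : Ideal D} [M.IsPrime] (hM : s.finiteType.IsQuasiMaximal M)
    (hsharp : s.finiteType.IsSharpAt M) {E : Submodule D K} (hE : s 1 / E = s 1) :
    1 / Submodule.span (localSubalgebra K M) (E : Set K) ≤ 1 := by
  intro z hz
  rw [Submodule.mem_one]
  suffices z ∈ localSubalgebra K M from ⟨⟨z, this⟩, rfl⟩
  by_contra hzM
  obtain ⟨c, hc, hcz, hczM⟩ :=
    hsharp.exists_mul_mem_theta (hP.mem_or_inv_mem_localizationAt hM) hzM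
  refine hczM (mem_localSubalgebra.mpr (hP.map_one_subset_localizationAt hM ?_))
  rw [SetLike.mem_coe, ← hE]
  refine hP.mem_map_one_div_of_mem_theta hM (le_map_one_of_map_one_div_eq hE) hcz fun e he => ?_
  obtain ⟨v, hv⟩ := Submodule.mem_one.mp <|
    Submodule.mem_div_iff_forall_mul_mem.mp hz e (Submodule.subset_span he)
  rw [← mem_localSubalgebra, mul_assoc, ← hv]
  exact mul_mem hc v.2

theorem IsPStarMD.exists_smul_mem_pow_two {s : SemistarOperation D K} (hP : s.IsPStarMD)
    {M : Ideal D} (hM : s.finiteType.IsQuasiMaximal M) (hsharp : s.finiteType.IsSharpAt M)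
    {E : Submodule D K} (hE : s 1 / E = s 1) {x : K} (hx : x ∈ E) : ∃ b ∉ M, b • x ∈ E ^ 2 := by
  have := hM.isPrime
  have := hP.valuationRing_localSubalgebra hM
  have hxV : x ∈ Submodule.span (localSubalgebra K M) (E : Set K) ^ 2 :=
    le_pow_two_of_one_div_le_one (hP.one_div_span_localSubalgebra_le_one hM hsharp hE)
      (Submodule.subset_span hx)
  rw [Submodule.span_pow] at hxV
  obtain ⟨b, hb⟩ := multiple_mem_span_of_mem_localization_span M.primeCompl
    (localSubalgebra K M) _ x hxV
  exact ⟨b, b.2, by rwa [Submodule.pow_eq_span_pow_set]⟩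

end

end SemistarOperation

open SemistarOperation in
theorem mainTheorem7_general {D K : Type*} [CommRing D] [IsDomain D] [Field K] [Algebra D K]
    [IsFractionRing D K] {s : SemistarOperation D K} (hsharp : s.finiteType.IsSharp)
    (hP : s.IsPStarMD) {E : Submodule D K} (hE0 : E ≠ ⊥) (hE : s 1 / E = s 1) :
    s.finiteType.IsIdempotent E := by
  have hE2 : E ^ 2 ≠ ⊥ := pow_ne_zero 2 hE0
  refine le_antisymm (s.finiteType.map_le_map_of_le_map hE0 hE2 fun x hx => ?_)
    (s.finiteType.map_le_map_of_le_map hE2 hE0 ?_)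
  · exact s.mem_finiteType_of_forall_isQuasiMaximal hE2 fun M hM =>
      hP.exists_smul_mem_pow_two hM (hsharp M hM) hE hx
  · rw [pow_two, Submodule.mul_le]
    exact fun x hx y hy => s.finiteType.mul_mem_map_of_mem_of_mem_map_one hE0 hx
      (s.finiteType_one ▸ le_map_one_of_map_one_div_eq hE hy)

theorem mainTheorem7 {D K : Type*} [CommRing D] [IsDomain D] [Field K] [Algebra D K]
    [IsFractionRing D K] :
    (∀ s : SemistarOperation D K, s.finiteType.IsSharp → s.IsPStarMD →
      ∀ I : Ideal D, I ≠ ⊥ →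
        s 1 / IsLocalization.coeSubmodule K I = s 1 →
        s.finiteType.IsIdempotent (IsLocalization.coeSubmodule K I)) ∧
    ((SemistarOperation.tOperation D K).IsSharp → SemistarOperation.IsPvMD D K →
      ∀ I : Ideal D, I ≠ ⊥ →
        (1 : Submodule D K) / IsLocalization.coeSubmodule K I = 1 →
        (SemistarOperation.tOperation D K).IsIdempotent (IsLocalization.coeSubmodule K I)) := by
  constructor
  · intro s hsharp hP I hI hdiv
    exact mainTheorem7_general hsharp hP (SemistarOperation.coeSubmodule_ne_bot hI) hdiv
  · intro hsharp hP I hI hdiv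
    exact mainTheorem7_general hsharp hP.isPStarMD (SemistarOperation.coeSubmodule_ne_bot hI)
      (by rwa [SemistarOperation.vOperation_one])
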